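/- Let $\mathcal M=(V,\{A_i\}_{i\in V},P)$ be a finite Markov decision process: $V$ is a finite set of states, $A_i$ is a finite nonempty set of actions at state $i$ (a state without a choice has exactly one action), and $P(i,a,\cdot)$ is a probability distribution on $V$ for $i\in V$, $a\in A_i$. For $\lambda\in\mathbb R$, $\zeta>0$ and $S\subseteq V$ let $$\mathcal P_\zeta(\lambda,S)=\{h\in\mathbb R^V:\ \overline A h\le b(S),\ \|h\|_\infty\le\zeta\},$$ where the rows are indexed by the pairs $(i,a)$ with $i\in V$, $a\in A_i$; $\overline A((i,a),j)=1-P(i,a,i)$ if $j=i$ and $-P(i,a,j)$ if $j\ne i$; $b(S)_{(i,a)}=1-\lambda$ if $i\in S$ and $1$ if $i\notin S$. Let $r_\lambda(S)=r_{\lambda,\zeta}(S)$ be the Lebesgue volume of $\mathcal P_\zeta(\lambda,S)$. For a stationary policy $\mu$ (with $\mu(i)\in A_i$) let $X_0=s,X_1,X_2,\dots$ be the Markov chain with transition probabilities $P(i,\mu(i),j)$, let $C(\mu,N)=1+\#\{1\le k\le N: X_k\in S\}$ be the cycle index at time $N$, and let the average cost per cycle (ACPC), every action having cost $1$, be $$J_\mu(s)=\limsup_{N\to\infty}\mathbf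 E\left\{\frac{\sum_{k=0}^{N}1}{C(\mu,N)}\right\}\in[0,\infty].$$ **Proposition.** 1. For every $\zeta>0$ and every $\lambda\in\mathbb R$, the function $S\mapsto r_\lambda(S)$ is supermodular, that is, $r_\lambda(S\cup\{v\})-r_\lambda(S)\le r_\lambda(T\cup\{v\})-r_\lambda(T)$ for all $S\subseteq T\subseteq V$ and $v\notin T$. If $\lambda\ge 0$, it is also decreasing (non-strictly). 2. For every $\lambda\in\mathbb R$ there is $\zeta_0>0$, depending only on $\mathcal M$ and $\lambda$, such that for all $\zeta\ge\zeta_0$ and all $S\subseteq V$: if $r_\lambda(S)=0$, then some initial state $s$ and some stationary policy $\mu$ satisfy $J_\mu(s)\le\max(\lambda,0)$ and, almost surely from $s$, $\limsup_{N} N/C(\mu,N)\le\max(\lambda,0)$. In particular, if the minimum ACPC does not depend on the initial state, it is at most $\max(\lambda,0)$. 3. Suppose that $\mathcal M$ is communicating: for all $i,j\in V$ there are states $i=k_0,k_1,\dots,k_m=j$ and actions $a_l\in A_{k_l}$ with $P(k_l,a_l,k_{l+1})>0$ for $0\le l<m$. Then there is $\zeta_0>0$, depending only on $\mathcal M$,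 such that for all $\zeta\ge\zeta_0$, all $\lambda\in\mathbb R$ and all $S\subseteq V$: if $r_\lambda(S)=0$, then there is one stationary policy $\mu$ such that, for every initial state $s$, $J_\mu(s)\le\max(\lambda,0)$ and, almost surely from $s$, $\limsup_{N} N/C(\mu,N)\le\max(\lambda,0)$. -/

import Mathlib

open MeasureTheory ProbabilityTheory Filter
open scoped ENNReal

noncomputable section

/-- A Markov decision process with state set `V` and action set `A i` at state `i`:
`P i a` is the law of the next state when action `a` is chosen at state `i`.
(A state without a choice is a state whose action set has exactly one element.) -/
structure MDP (V : Type*) (A : V → Type*) where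
  P : (i : V) → A i → PMF V

/-- A function `f` on the subsets of a finite set is submodular if
`f (S ∪ {v}) - f S ≥ f (T ∪ {v}) - f T` for all `S ⊆ T` and `v ∉ T`. -/
def IsSubmodularFun {V : Type*} [DecidableEq V] (f : Finset V → ℝ) : Prop :=
  ∀ S T : Finset V, S ⊆ T → ∀ v : V, v ∉ T →
    f (insert v S) - f S ≥ f (insert v T) - f T

/-- `f` is supermodular if `-f` is submodular. -/
def IsSupermodularFun {V : Type*} [DecidableEq V] (f : Finset V → ℝ) : Prop :=
  IsSubmodularFun (fun S => -f S)

namespace MDP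

variable {V : Type*} {A : V → Type*}

/-- The transition probability `P(i,a,j)` as a real number. -/
def prob (M : MDP V A) (i : V) (a : A i) (j : V) : ℝ := (M.P i a j).toReal

/-- A stationary control policy chooses an admissible action at each state. -/
abbrev Policy (_M : MDP V A) : Type _ := (i : V) → A i

/-- Every state can be reached from every state by choosing suitable actions. -/
def Communicating (M : MDP V A) : Prop :=
  ∀ i j : V, Relation.ReflTransGen (fun k l : V => ∃ a : A k, 0 < M.prob k a l) i j

/-! ### The polytope -/

/-- The matrix with rows indexed by the state-action pairs `(i,a)`, `a ∈ A i`, whose `((i,a),j)`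
entry is `-P(i,a,j)` if `i ≠ j` and `1 - P(i,a,j)` if `i = j`. -/
def Abar [DecidableEq V] (M : MDP V A) : Matrix (Σ i : V, A i) V ℝ :=
  Matrix.of fun r j => if r.1 = j then 1 - M.prob r.1 r.2 j else -M.prob r.1 r.2 j

/-- The right-hand side: its `(i,a)` entry is `1 - lam` if `i ∈ S` and `1` otherwise. -/
def rhs [DecidableEq V] (_M : MDP V A) (lam : ℝ) (S : Finset V) : (Σ i : V, A i) → ℝ :=
  fun r => if r.1 ∈ S then 1 - lam else 1

/-- The polytope `{h : Abar h ≤ b(S)} ∩ {‖h‖_∞ ≤ ζ}`; the norm of `V → ℝ` is the sup norm. -/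
def polytope [Fintype V] [DecidableEq V] (M : MDP V A) (ζ lam : ℝ) (S : Finset V) :
    Set (V → ℝ) :=
  {h | Matrix.mulVec M.Abar h ≤ M.rhs lam S} ∩ {h | ‖h‖ ≤ ζ}

/-- The Lebesgue volume of the polytope. -/
def vol [Fintype V] [DecidableEq V] (M : MDP V A) (ζ lam : ℝ) (S : Finset V) : ℝ :=
  (volume (M.polytope ζ lam S)).toReal

/-! ### The controlled random walk and its average cost per cycle -/

section Walk

variable [Fintype V] [MeasurableSpace V] [MeasurableSingletonClass V]

/-- The Markov kernel with transition matrix `P_μ(i,j) = P(i,μ(i),j)`. -/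
def kernel (M : MDP V A) (μ : M.Policy) : Kernel V V :=
  Kernel.ofFunOfCountable fun i => (M.P i (μ i)).toMeasure

instance (M : MDP V A) (μ : M.Policy) : IsMarkovKernel (M.kernel μ) :=
  ⟨fun i => (inferInstance : IsProbabilityMeasure (M.P i (μ i)).toMeasure)⟩

/-- The transition at time `n`, as a kernel on the history up to time `n`; it uses only the
state at time `n`. -/
def step (M : MDP V A) (μ : M.Policy) (n : ℕ) : Kernel ((_i : Finset.Iic n) → V) V :=
  (M.kernel μ).comap (fun x => x ⟨n, Finset.mem_Iic.2 le_rfl⟩) (measurable_pi_apply _)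

instance (M : MDP V A) (μ : M.Policy) (n : ℕ) : IsMarkovKernel (M.step μ n) := by
  unfold step; infer_instance

/-- The law of the random walk `X_0 = s, X_1, X_2, …` induced by the policy `μ`. -/
def walk (M : MDP V A) (μ : M.Policy) (s : V) : Measure (ℕ → V) :=
  Kernel.trajMeasure (X := fun _ => V) (Measure.dirac s) (M.step μ)

end Walk

/-- The cycle index of the trajectory `x` at time `N`. A cycle is completed at each time `k ≥ 1`
with `x k ∈ S`, and the cycle that starts at time `0` has index `1`; so this is one more than the
number of cycles completed by time `N`. -/
def cycles [DecidableEq V] (S : Finset V) (x : ℕ → V) (N : ℕ) : ℕ :=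
  1 + ((Finset.Icc 1 N).filter fun k => x k ∈ S).card

/-- The average cost per cycle from the initial state `s` under the policy `μ`, every action
having cost `1`:  `limsup_N E[(∑_{k=0}^N 1) / C(μ,N)]`. -/
def acpc [Fintype V] [DecidableEq V] [MeasurableSpace V] [MeasurableSingletonClass V]
    (M : MDP V A) (S : Finset V) (μ : M.Policy) (s : V) : ℝ≥0∞ :=
  limsup (fun N : ℕ => ∫⁻ x, (∑ _k ∈ Finset.range (N + 1), (1 : ℝ≥0∞)) / (cycles S x N : ℝ≥0∞)
    ∂(M.walk μ s)) atTop

/-- The average number of steps per cycle along the trajectory `x`: `limsup_N N / C(N)`. -/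
def pathAcpc [DecidableEq V] (S : Finset V) (x : ℕ → V) : ℝ≥0∞ :=
  limsup (fun N : ℕ => (N : ℝ≥0∞) / (cycles S x N : ℝ≥0∞)) atTop

end MDP

end

noncomputable section

namespace MDP

variable {V : Type*} {A : V → Type*}

/-! The volume statement is inclusion–exclusion: adding a state to `S` only moves right-hand sides
between `1` and `1 - lam`, so the polytopes of `insert v S` and `T` intersect inside one of those of
`S` and `insert v T` and have their union inside the other (`vol_add_vol_le`); the sign of `lam`
decides which.

For the cost bounds, zero volume at large `ζ` means that no `h` satisfies `h i - E h(next) < cost i`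
strictly, since a strict solution of norm below `ζ` has a neighbourhood in the polytope. The dual of
this infeasibility is a stationary policy whose average of `cost` is nonpositive somewhere
(`exists_gain_nonpos`). It is found by vanishing discount: an everywhere positive optimal discounted
value would be strictly feasible, so each such value is nonpositive at some state. One policy and
one state recur for infinitely many discount factors, and `(1 - β) v` tends to the gain `g` of that
policy (`abs_discounted_sub_gain_le`).

The states minimizing `g` are closed under the policy. On them `cost ≤ h - E h(next)`, with `h` from
the Poisson equation, so `cost` plus the increment of `h` has nonpositive drift. As the total cost
up to `N` is at least `N - lam * C`, long average cycles are large deviations of a supermartingale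
(`exists_deviation_bound`). Their exponentially small probability gives the almost sure bound by
Borel–Cantelli and the bound in expectation because the ratio never exceeds `N + 1`.

In a communicating process, functions with `v ≤ B + E v(next)` have bounded span. This makes `ζ₀`
independent of `lam` and the gain nonpositive at every state. -/

/-- The expectation of `h` at the next state, when action `a` is chosen at state `i`. -/
def mean [Fintype V] (M : MDP V A) (i : V) (a : A i) (h : V → ℝ) : ℝ :=
  ∑ j, M.prob i a j * h j

lemma prob_nonneg (M : MDP V A) (i : V) (a : A i) (j : V) : 0 ≤ M.prob i a j :=
  ENNReal.toReal_nonneg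

/-! ### One-step expectations -/

section Mean

variable [Fintype V]

lemma sum_prob (M : MDP V A) (i : V) (a : A i) : ∑ j, M.prob i a j = 1 := by
  unfold prob
  rw [← ENNReal.toReal_sum fun j _ => (M.P i a).apply_ne_top j, ← tsum_fintype (L := .unconditional V),
    (M.P i a).tsum_coe, ENNReal.toReal_one]

lemma mean_add (M : MDP V A) (i : V) (a : A i) (g h : V → ℝ) :
    M.mean i a (g + h) = M.mean i a g + M.mean i a h := by
  simp [mean, mul_add, Finset.sum_add_distrib]

lemma mean_sub (M : MDP V A) (i : V) (a : A i) (g h : V → ℝ) :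
    M.mean i a (g - h) = M.mean i a g - M.mean i a h := by
  simp [mean, mul_sub, Finset.sum_sub_distrib]

lemma mean_smul (M : MDP V A) (i : V) (a : A i) (t : ℝ) (h : V → ℝ) :
    M.mean i a (t • h) = t * M.mean i a h := by
  simp only [mean, Finset.mul_sum, Pi.smul_apply, smul_eq_mul]
  exact Finset.sum_congr rfl fun j _ => by ring

lemma mean_const (M : MDP V A) (i : V) (a : A i) (t : ℝ) : M.mean i a (fun _ => t) = t := by
  rw [mean, ← Finset.sum_mul, sum_prob, one_mul]

lemma mean_mono (M : MDP V A) (i : V) (a : A i) {g h : V → ℝ} (hgh : g ≤ h) :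
    M.mean i a g ≤ M.mean i a h :=
  Finset.sum_le_sum fun j _ => mul_le_mul_of_nonneg_left (hgh j) (M.prob_nonneg i a j)

lemma mean_le (M : MDP V A) (i : V) (a : A i) {h : V → ℝ} {t : ℝ} (ht : ∀ j, h j ≤ t) :
    M.mean i a h ≤ t :=
  (M.mean_mono i a (h := fun _ => t) ht).trans_eq (M.mean_const i a t)

lemma le_mean (M : MDP V A) (i : V) (a : A i) {h : V → ℝ} {t : ℝ} (ht : ∀ j, t ≤ h j) :
    t ≤ M.mean i a h :=
  (M.mean_const i a t).symm.trans_le (M.mean_mono i a (g := fun _ => t) ht)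

lemma abs_mean_le (M : MDP V A) (i : V) (a : A i) (h : V → ℝ) : |M.mean i a h| ≤ ‖h‖ :=
  abs_le.2 ⟨M.le_mean i a fun j => (abs_le.1 (norm_le_pi_norm h j)).1,
    M.mean_le i a fun j => (abs_le.1 (norm_le_pi_norm h j)).2⟩

/-- If `h ≤ t` everywhere, then the mean of `h` falls short of `t` by at least the shortfall at a
single state, weighted with its probability. -/
lemma mean_le_sub (M : MDP V A) (i : V) (a : A i) {h : V → ℝ} {t : ℝ} (ht : ∀ j, h j ≤ t)
    (j : V) : M.mean i a h ≤ t - M.prob i a j * (t - h j) := by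
  have h1 : M.prob i a j * (t - h j) ≤ M.mean i a ((fun _ => t) - h) :=
    Finset.single_le_sum (f := fun j => M.prob i a j * ((fun _ => t) - h : V → ℝ) j)
      (fun k _ => mul_nonneg (M.prob_nonneg i a k) (sub_nonneg.2 (ht k))) (Finset.mem_univ j)
  rw [mean_sub, mean_const] at h1
  linarith

lemma continuous_mean (M : MDP V A) (i : V) (a : A i) : Continuous (M.mean i a) := by
  unfold mean; fun_prop

end Mean

/-! ### Costs, polytopes and their volumes -/

section Cost

variable [DecidableEq V]

/-- The cost `1 - lam` on `S` and `1` off `S`. -/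
def cost (lam : ℝ) (S : Finset V) (i : V) : ℝ := if i ∈ S then 1 - lam else 1

lemma cost_anti {lam : ℝ} (hlam : 0 ≤ lam) {S T : Finset V} (hST : S ⊆ T) :
    cost lam T ≤ cost lam S := by
  intro i
  unfold cost
  have := @hST i
  split_ifs <;> first | linarith | tauto

lemma cost_mono {lam : ℝ} (hlam : lam ≤ 0) {S T : Finset V} (hST : S ⊆ T) :
    cost lam S ≤ cost lam T := by
  intro i
  unfold cost
  have := @hST i
  split_ifs <;> first | linarith | tauto

end Cost

section Polytope

variable [Fintype V] [DecidableEq V]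

lemma mulVec_Abar (M : MDP V A) (h : V → ℝ) (r : Σ i : V, A i) :
    Matrix.mulVec M.Abar h r = h r.1 - M.mean r.1 r.2 h := by
  have (j : V) : M.Abar r j * h j = (if r.1 = j then h j else 0) - M.prob r.1 r.2 j * h j := by
    simp only [Abar, Matrix.of_apply]; split_ifs <;> ring
  simp [Matrix.mulVec, dotProduct, this, Finset.sum_sub_distrib, mean]

lemma mem_polytope {M : MDP V A} {ζ lam : ℝ} {S : Finset V} {h : V → ℝ} :
    h ∈ M.polytope ζ lam S ↔ (∀ i a, h i - M.mean i a h ≤ cost lam S i) ∧ ‖h‖ ≤ ζ := by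
  simp only [polytope, Set.mem_inter_iff, Set.mem_ofPred_eq, Pi.le_def, mulVec_Abar, Sigma.forall]
  rfl

lemma isClosed_polytope (M : MDP V A) (ζ lam : ℝ) (S : Finset V) :
    IsClosed (M.polytope ζ lam S) := by
  have : M.polytope ζ lam S =
      (⋂ i, ⋂ a, {h | h i - M.mean i a h ≤ cost lam S i}) ∩ {h | ‖h‖ ≤ ζ} := by
    ext h; simp [mem_polytope]
  rw [this]
  refine (isClosed_iInter fun i => isClosed_iInter fun a => isClosed_le ?_ continuous_const).inter
    (isClosed_le continuous_norm continuous_const)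
  exact (continuous_apply i).sub (M.continuous_mean i a)

lemma volume_polytope_ne_top (M : MDP V A) (ζ lam : ℝ) (S : Finset V) :
    volume (M.polytope ζ lam S) ≠ ∞ := by
  refine ((measure_mono fun h hh => ?_).trans_lt
    (isCompact_closedBall (0 : V → ℝ) ζ).measure_lt_top).ne
  simpa using (mem_polytope.1 hh).2

lemma polytope_mono (M : MDP V A) (ζ : ℝ) {lam : ℝ} {S T : Finset V}
    (hST : cost lam S ≤ cost lam T) : M.polytope ζ lam S ⊆ M.polytope ζ lam T := by
  intro h hh
  rw [mem_polytope] at hh ⊢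
  exact ⟨fun i a => (hh.1 i a).trans (hST i), hh.2⟩

lemma vol_mono (M : MDP V A) (ζ : ℝ) {lam : ℝ} {S T : Finset V}
    (hST : cost lam S ≤ cost lam T) : M.vol ζ lam S ≤ M.vol ζ lam T :=
  ENNReal.toReal_mono (M.volume_polytope_ne_top ζ lam T) (measure_mono (M.polytope_mono ζ hST))

/-- If the constraints of `U` and `W` imply those of `C` jointly and those of `D` separately, then
the volumes of `C` and `D` add up to at least those of `U` and `W`. -/
lemma vol_add_vol_le (M : MDP V A) (ζ : ℝ) {lam : ℝ} {U W C D : Finset V}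
    (hC : cost lam U ⊓ cost lam W ≤ cost lam C) (hU : cost lam U ≤ cost lam D)
    (hW : cost lam W ≤ cost lam D) :
    M.vol ζ lam U + M.vol ζ lam W ≤ M.vol ζ lam C + M.vol ζ lam D := by
  unfold vol
  rw [← ENNReal.toReal_add (M.volume_polytope_ne_top _ _ _) (M.volume_polytope_ne_top _ _ _),
    ← ENNReal.toReal_add (M.volume_polytope_ne_top _ _ _) (M.volume_polytope_ne_top _ _ _)]
  refine ENNReal.toReal_mono (ENNReal.add_ne_top.2
    ⟨M.volume_polytope_ne_top _ _ _, M.volume_polytope_ne_top _ _ _⟩) ?_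
  rw [← measure_union_add_inter _ (M.isClosed_polytope ζ lam W).measurableSet, add_comm]
  refine add_le_add (measure_mono fun h hh => ?_)
    (measure_mono (Set.union_subset (M.polytope_mono ζ hU) (M.polytope_mono ζ hW)))
  have h1 := mem_polytope.1 hh.1
  have h2 := mem_polytope.1 hh.2
  exact mem_polytope.2 ⟨fun i a => (le_inf (h1.1 i a) (h2.1 i a)).trans (hC i), h1.2⟩

theorem vol_antitone (M : MDP V A) (ζ : ℝ) {lam : ℝ} (hlam : 0 ≤ lam) :
    Antitone (M.vol ζ lam) := fun _ _ hST => M.vol_mono ζ (cost_anti hlam hST)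

theorem vol_supermodular (M : MDP V A) (ζ lam : ℝ) : IsSupermodularFun (M.vol ζ lam) := by
  intro S T hST v hv
  have key : M.vol ζ lam (insert v S) + M.vol ζ lam T ≤
      M.vol ζ lam (insert v T) + M.vol ζ lam S := by
    -- For `lam ≥ 0` enlarging the set shrinks the polytope, so `insert v T` receives the
    -- intersection and `S` the union. For `lam ≤ 0` these roles are exchanged.
    rcases le_total 0 lam with hlam | hlam
    · refine M.vol_add_vol_le ζ (fun i => ?_) (cost_anti hlam (Finset.subset_insert v S))
        (cost_anti hlam hST)
      by_cases hi : i = v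
      · exact inf_le_left.trans_eq (by simp [cost, hi])
      · exact inf_le_right.trans_eq (by simp [cost, hi])
    · rw [add_comm (M.vol ζ lam (insert v T))]
      refine M.vol_add_vol_le ζ (fun i => ?_) (cost_mono hlam (Finset.insert_subset_insert v hST))
        (cost_mono hlam (Finset.subset_insert v T))
      by_cases hi : i = v
      · refine inf_le_right.trans_eq ?_
        subst hi
        simp [cost, hv, Finset.notMem_mono hST hv]
      · exact inf_le_left.trans_eq (by simp [cost, hi])
  linarith

/-- A vector that satisfies all constraints of the polytope, the bound on the norm excepted,
strictly. -/
def StrictlyFeasible (M : MDP V A) (lam : ℝ) (S : Finset V) (h : V → ℝ) : Prop :=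
  ∀ i a, h i - M.mean i a h < cost lam S i

lemma strictlyFeasible_zero (M : MDP V A) {lam : ℝ} (hlam : lam < 1) (S : Finset V) :
    M.StrictlyFeasible lam S 0 := by
  intro i a
  have : M.mean i a 0 = 0 := by simp [mean]
  rw [this, Pi.zero_apply, sub_zero]
  unfold cost
  split_ifs <;> linarith

lemma vol_ne_zero [∀ i, Finite (A i)] {M : MDP V A} {ζ lam : ℝ} {S : Finset V} {h : V → ℝ}
    (hh : M.StrictlyFeasible lam S h) (hζ : ‖h‖ < ζ) : M.vol ζ lam S ≠ 0 := by
  have ho : IsOpen ((⋂ i, ⋂ a, {h | h i - M.mean i a h < cost lam S i}) ∩ {h | ‖h‖ < ζ}) := by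
    refine (isOpen_iInter_of_finite fun i => isOpen_iInter_of_finite fun a =>
      isOpen_lt ?_ continuous_const).inter (isOpen_lt continuous_norm continuous_const)
    exact (continuous_apply i).sub (M.continuous_mean i a)
  have hpos := ho.measure_pos volume ⟨h, by simpa using ⟨hh, hζ⟩⟩
  refine (ENNReal.toReal_pos (hpos.trans_le (measure_mono fun g hg => ?_)).ne'
    (M.volume_polytope_ne_top _ _ _)).ne'
  simp only [Set.mem_inter_iff, Set.mem_iInter, Set.mem_ofPred_eq] at hg
  exact mem_polytope.2 ⟨fun i a => (hg.1 i a).le, hg.2.le⟩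

/-- A uniform bound `ζ₀` such that zero volume for some `ζ ≥ ζ₀` excludes strictly feasible
vectors of any norm. -/
lemma exists_forall_not_strictlyFeasible [∀ i, Finite (A i)] (M : MDP V A) (lam : ℝ) :
    ∃ ζ₀ : ℝ, 0 < ζ₀ ∧ ∀ ζ, ζ₀ ≤ ζ → ∀ S : Finset V, M.vol ζ lam S = 0 →
      ∀ h, ¬ M.StrictlyFeasible lam S h := by
  classical
  choose! w hw using fun (S : Finset V) (hS : ∃ h, M.StrictlyFeasible lam S h) => hS
  -- There are finitely many `S`, so one radius exceeds the norms of all chosen witnesses.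
  refine ⟨1 + ∑ S, ‖w S‖, by positivity, fun ζ hζ S hvol h hh => vol_ne_zero (hw S ⟨h, hh⟩) ?_ hvol⟩
  have := Finset.single_le_sum (f := fun S => ‖w S‖) (fun S _ => norm_nonneg _) (Finset.mem_univ S)
  linarith

end Polytope

/-! ### Span bounds in communicating processes -/

section Communicating

variable [Fintype V]

/-- In a communicating process the span of an approximately subharmonic function is bounded. -/
lemma Communicating.exists_span_le {M : MDP V A} (hM : M.Communicating) (B : ℝ) :
    ∃ K : ℝ, 0 ≤ K ∧ ∀ v : V → ℝ, (∀ i a, v i ≤ B + M.mean i a v) → ∀ i j, v i - v j ≤ K := by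
  have h1 (i j : V) : ∃ K : ℝ, 0 ≤ K ∧ ∀ v : V → ℝ, (∀ i a, v i ≤ B + M.mean i a v) →
      (∀ k, v k ≤ v i) → v i - v j ≤ K := by
    induction hM i j with
    | refl => exact ⟨0, le_rfl, fun v _ _ => by simp⟩
    | @tail j k _ hjk ih =>
      obtain ⟨K, hK, ih⟩ := ih
      obtain ⟨a, ha⟩ := hjk
      -- With `v i` maximal, `v j ≤ B + v i - p * (v i - v k)`, where `p` is the probability of the
      -- last edge. Hence `p * (v i - v k) ≤ B + K`.
      refine ⟨(K + |B|) / M.prob j a k, by positivity, fun v hv hi => ?_⟩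
      have h2 := ih v hv hi
      have h3 := hv j a
      have h4 := M.mean_le_sub j a hi k
      rw [le_div_iff₀ ha, mul_comm]
      linarith [le_abs_self B]
  choose K hK h1 using h1
  refine ⟨∑ i, ∑ j, K i j, Finset.sum_nonneg fun i _ => Finset.sum_nonneg fun j _ => hK i j,
    fun v hv i j => ?_⟩
  have : Nonempty V := ⟨i⟩
  obtain ⟨m, hm⟩ := Finite.exists_max v
  calc v i - v j ≤ v m - v j := by linarith [hm i]
    _ ≤ K m j := h1 m j v hv hm
    _ ≤ ∑ j, K m j := Finset.single_le_sum (fun j _ => hK m j) (Finset.mem_univ j)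
    _ ≤ ∑ i, ∑ j, K i j := Finset.single_le_sum (f := fun i => ∑ j, K i j)
      (fun i _ => Finset.sum_nonneg fun j _ => hK i j) (Finset.mem_univ m)

/-- In a communicating process one bound `ζ₀` serves for all `lam`. -/
lemma Communicating.exists_forall_not_strictlyFeasible [DecidableEq V] [∀ i, Finite (A i)]
    {M : MDP V A} (hM : M.Communicating) :
    ∃ ζ₀ : ℝ, 0 < ζ₀ ∧ ∀ ζ, ζ₀ ≤ ζ → ∀ (lam : ℝ) (S : Finset V), M.vol ζ lam S = 0 →
      ∀ h, ¬ M.StrictlyFeasible lam S h := by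
  obtain ⟨K, hK, hspan⟩ := hM.exists_span_le 1
  refine ⟨K + 1, by positivity, fun ζ hζ lam S hvol h hh => ?_⟩
  rcases lt_or_ge lam 1 with hlam | hlam
  · exact vol_ne_zero (M.strictlyFeasible_zero hlam S) (by rw [norm_zero]; linarith) hvol
  have hsub (i : V) (a : A i) : h i ≤ 1 + M.mean i a h := by
    have h1 := hh i a
    have h2 : cost lam S i ≤ 1 := by unfold cost; split_ifs <;> linarith
    linarith
  rcases isEmpty_or_nonempty V with hV | ⟨⟨i₀⟩⟩
  · exact vol_ne_zero hh (by rw [Subsingleton.elim h 0, norm_zero]; linarith) hvol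
  -- Adding constants preserves strict feasibility, so `h` may vanish at `i₀`; its norm is then at
  -- most its span.
  refine vol_ne_zero (h := h - fun _ => h i₀) (fun i a => ?_) ?_ hvol
  · rw [mean_sub, mean_const, Pi.sub_apply]
    linarith [hh i a]
  · refine lt_of_le_of_lt ((pi_norm_le_iff_of_nonneg hK).2 fun i => ?_)
      (lt_of_lt_of_le (lt_add_one K) hζ)
    rw [Real.norm_eq_abs, abs_le]
    constructor <;> simp only [Pi.sub_apply] <;> linarith [hspan h hsub i i₀, hspan h hsub i₀ i]

end Communicating

lemma nonpos_of_infinite_le_div {s : Set ℕ} (hs : s.Infinite) {x C : ℝ}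
    (hx : ∀ n ∈ s, x ≤ C / (n + 2)) : x ≤ 0 := by
  by_contra! h
  obtain ⟨N, hN⟩ := exists_nat_gt (C / x)
  obtain ⟨n, hn, hNn⟩ := hs.exists_gt N
  have h1 := hx n hn
  have h2 : (N : ℝ) < n := by exact_mod_cast hNn
  rw [le_div_iff₀ (by positivity)] at h1
  rw [div_lt_iff₀ h] at hN
  nlinarith

/-! ### Discounted values, the Poisson equation and the gain -/

section Discounted

variable [Fintype V]

/-- The Bellman equation of the discounted problem has a solution, and a policy attains the
minimum. -/
lemma exists_discounted [∀ i, Finite (A i)] [∀ i, Nonempty (A i)] (M : MDP V A) (c : V → ℝ)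
    {β : ℝ} (hβ : 0 ≤ β) (hβ1 : β < 1) :
    ∃ (v : V → ℝ) (μ : M.Policy), (∀ i, v i = c i + β * M.mean i (μ i) v) ∧
      ∀ i a, v i ≤ c i + β * M.mean i a v := by
  let T : (V → ℝ) → V → ℝ := fun v i => c i + β * ⨅ a, M.mean i a v
  have hle (v : V → ℝ) (i : V) (a : A i) : T v i ≤ c i + β * M.mean i a v :=
    add_le_add_right (mul_le_mul_of_nonneg_left (ciInf_le (Set.finite_range _).bddBelow a) hβ) _
  have hex (v : V → ℝ) (i : V) : ∃ a, T v i = c i + β * M.mean i a v := by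
    obtain ⟨a, ha⟩ := exists_eq_ciInf_of_finite (f := fun a => M.mean i a v)
    exact ⟨a, by simp only [T, ha]⟩
  have hT (v w : V → ℝ) (i : V) : T v i - T w i ≤ β * ‖v - w‖ := by
    obtain ⟨a, ha⟩ := hex w i
    have h1 := hle v i a
    have h2 := (abs_le.1 (M.abs_mean_le i a (v - w))).2
    rw [mean_sub] at h2
    nlinarith [mul_le_mul_of_nonneg_left h2 hβ]
  have hC : ContractingWith ⟨β, hβ⟩ T := by
    refine ⟨hβ1, LipschitzWith.of_dist_le_mul fun v w => ?_⟩
    rw [dist_eq_norm, dist_eq_norm]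
    refine (pi_norm_le_iff_of_nonneg (mul_nonneg hβ (norm_nonneg _))).2 fun i => ?_
    rw [Real.norm_eq_abs, abs_le]
    have h1 := hT v w i
    have h2 := hT w v i
    rw [norm_sub_rev] at h2
    constructor
    · change -(β * ‖v - w‖) ≤ T v i - T w i
      linarith
    · exact h1
  have hfix : T (hC.fixedPoint T) = hC.fixedPoint T := hC.fixedPoint_isFixedPt
  choose μ hμ using hex (hC.fixedPoint T)
  refine ⟨hC.fixedPoint T, μ, fun i => ?_, fun i a => ?_⟩
  · rw [← hμ i, hfix]
  · exact (congrFun hfix i).symm.trans_le (hle _ i a)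

lemma norm_le_of_discounted {M : MDP V A} {c v : V → ℝ} {μ : M.Policy} {β : ℝ} (hβ : 0 ≤ β)
    (hv : ∀ i, v i = c i + β * M.mean i (μ i) v) : (1 - β) * ‖v‖ ≤ ‖c‖ := by
  have : ‖v‖ ≤ ‖c‖ + β * ‖v‖ := by
    refine (pi_norm_le_iff_of_nonneg (by positivity)).2 fun i => ?_
    rw [hv i]
    refine (norm_add_le _ _).trans (add_le_add (norm_le_pi_norm c i) ?_)
    rw [norm_mul, Real.norm_of_nonneg hβ]
    exact mul_le_mul_of_nonneg_left (M.abs_mean_le _ _ _) hβ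
  linarith

/-- The transition operator of a policy. -/
def meanLin (M : MDP V A) (μ : M.Policy) : (V → ℝ) →ₗ[ℝ] V → ℝ where
  toFun h i := M.mean i (μ i) h
  map_add' g h := funext fun i => M.mean_add i (μ i) g h
  map_smul' t h := funext fun i => M.mean_smul i (μ i) t h

/-- The Poisson equation: `c` decomposes into a harmonic gain `g` and a coboundary. -/
lemma exists_poisson (M : MDP V A) (μ : M.Policy) (c : V → ℝ) :
    ∃ g h : V → ℝ, (∀ i, M.mean i (μ i) g = g i) ∧ ∀ i, c i = g i + (h i - M.mean i (μ i) h) := by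
  let L := M.meanLin μ
  have hL (h : V → ℝ) : ‖L h‖ ≤ ‖h‖ :=
    (pi_norm_le_iff_of_nonneg (norm_nonneg h)).2 fun i => M.abs_mean_le i (μ i) h
  let D : (V → ℝ) →ₗ[ℝ] V → ℝ := LinearMap.id - L
  have hdisj : Disjoint (LinearMap.ker D) (LinearMap.range D) := by
    rw [Submodule.disjoint_def]
    rintro x hx ⟨y, hy⟩
    have hx' : L x = x := (sub_eq_zero.1 (LinearMap.mem_ker.1 hx)).symm
    have hy' : L y = y - x := by rw [← hy]; simp [D]
    -- The vector `y - n • x` is the `n`-th iterate of `L` at `y`, hence bounded, which forces `x =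
    -- 0`.
    have hn (n : ℕ) : ‖y - (n : ℝ) • x‖ ≤ ‖y‖ := by
      induction n with
      | zero => simp
      | succ n ih =>
        have : y - ((n + 1 : ℕ) : ℝ) • x = L (y - (n : ℝ) • x) := by
          rw [map_sub, map_smul, hx', hy']
          push_cast
          module
        rw [this]
        exact (hL _).trans ih
    by_contra hne
    obtain ⟨n, hn'⟩ := exists_nat_gt (2 * ‖y‖ / ‖x‖)
    rw [div_lt_iff₀ (norm_pos_iff.2 hne)] at hn'
    have h1 : ‖(n : ℝ) • x‖ ≤ ‖y‖ + ‖y - (n : ℝ) • x‖ := by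
      simpa using norm_sub_le y (y - (n : ℝ) • x)
    rw [norm_smul, Real.norm_natCast] at h1
    linarith [hn n]
  have htop : LinearMap.ker D ⊔ LinearMap.range D = ⊤ :=
    Submodule.eq_top_of_disjoint _ _ (by rw [add_comm, D.finrank_range_add_finrank_ker]) hdisj
  obtain ⟨g, hg, d, ⟨h, rfl⟩, hgd⟩ := Submodule.mem_sup.1 (htop ▸ Submodule.mem_top (x := c))
  refine ⟨g, h, fun i => ?_, fun i => ?_⟩
  · exact congrFun (sub_eq_zero.1 (LinearMap.mem_ker.1 hg)).symm i
  · rw [← hgd]; rfl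

/-- The normalized discounted cost of a policy approaches its gain, with an explicit rate. -/
lemma abs_discounted_sub_gain_le {M : MDP V A} {μ : M.Policy} {c g h v : V → ℝ} {β : ℝ}
    (hβ : 0 ≤ β) (hβ1 : β < 1) (hg : ∀ i, M.mean i (μ i) g = g i)
    (hc : ∀ i, c i = g i + (h i - M.mean i (μ i) h))
    (hv : ∀ i, v i = c i + β * M.mean i (μ i) v) (i : V) :
    |(1 - β) * v i - g i| ≤ (1 - β) * (2 * ‖h‖) := by
  have h1β : 0 < 1 - β := by linarith
  -- Correcting by `h` leaves an error of order `(1 - β) ^ 2` in the recursion for `u`. The maximum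
  -- principle loses one factor `1 - β`.
  set u : V → ℝ := (1 - β) • (v - h) - g with hu
  have hrec (j : V) : u j = β * M.mean j (μ j) u - (1 - β) * (1 - β) * M.mean j (μ j) h := by
    rw [hu, mean_sub, mean_smul, mean_sub, hg]
    simp only [Pi.sub_apply, Pi.smul_apply, smul_eq_mul]
    linear_combination (1 - β) * hv j + (1 - β) * hc j
  have hh (j : V) := mul_le_mul_of_nonneg_left (M.abs_mean_le j (μ j) h) h1β.le
  have : Nonempty V := ⟨i⟩
  obtain ⟨m, hm⟩ := Finite.exists_max u
  obtain ⟨l, hl⟩ := Finite.exists_min u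
  have hm1 : u m ≤ (1 - β) * ‖h‖ := by
    have h2 := mul_le_mul_of_nonneg_left (M.mean_le m (μ m) hm) hβ
    have h3 := mul_le_mul_of_nonneg_left
      (mul_le_mul_of_nonneg_left (abs_le.1 (M.abs_mean_le m (μ m) h)).1 h1β.le) h1β.le
    refine le_of_mul_le_mul_left ?_ h1β
    linarith [hrec m]
  have hl1 : -((1 - β) * ‖h‖) ≤ u l := by
    have h2 := mul_le_mul_of_nonneg_left (M.le_mean l (μ l) hl) hβ
    have h3 := mul_le_mul_of_nonneg_left
      (mul_le_mul_of_nonneg_left (abs_le.1 (M.abs_mean_le l (μ l) h)).2 h1β.le) h1β.le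
    refine le_of_mul_le_mul_left ?_ h1β
    linarith [hrec l]
  have h4 := abs_le.1 (norm_le_pi_norm h i)
  have h5 := mul_le_mul_of_nonneg_left h4.1 h1β.le
  have h6 := mul_le_mul_of_nonneg_left h4.2 h1β.le
  have h7 : u i = (1 - β) * v i - (1 - β) * h i - g i := by
    simp only [hu, Pi.sub_apply, Pi.smul_apply, smul_eq_mul]; ring
  rw [abs_le]
  constructor <;> linarith [hm i, hl i]

/-- The states at which a harmonic function is minimal are closed under the transitions. -/
lemma closed_argmin_of_harmonic {M : MDP V A} {μ : M.Policy} {g : V → ℝ}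
    (hg : ∀ i, M.mean i (μ i) g = g i) {i j : V} (hi : ∀ k, g i ≤ g k)
    (hij : 0 < M.prob i (μ i) j) : g j = g i := by
  have h1 := M.mean_le_sub i (μ i) (h := 0 - g) (t := - g i) (fun k => by simpa using hi k) j
  have h0 : M.mean i (μ i) 0 = 0 := by simp [mean]
  rw [mean_sub, hg, h0, Pi.sub_apply, Pi.zero_apply] at h1
  have h2 : M.prob i (μ i) j * (g j - g i) ≤ 0 := by linarith
  have h3 := nonpos_of_mul_nonpos_right h2 hij
  linarith [hi j]

end Discounted

/-! ### From infeasibility to a policy of nonpositive gain -/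

section Duality

variable [Fintype V] [DecidableEq V]

lemma one_le_of_forall_not_strictlyFeasible {M : MDP V A} {lam : ℝ} {S : Finset V}
    (hS : ∀ h, ¬ M.StrictlyFeasible lam S h) : 1 ≤ lam :=
  not_lt.1 fun h => hS 0 (M.strictlyFeasible_zero h S)

variable [∀ i, Finite (A i)] [∀ i, Nonempty (A i)]

/-- If no vector is strictly feasible, then some stationary policy has nonpositive gain at some
state, and even at all states if the process is communicating. -/
lemma exists_gain_nonpos {M : MDP V A} {lam : ℝ} {S : Finset V}
    (hS : ∀ h, ¬ M.StrictlyFeasible lam S h) :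
    ∃ (μ : M.Policy) (g h : V → ℝ), (∀ i, M.mean i (μ i) g = g i) ∧
      (∀ i, cost lam S i = g i + (h i - M.mean i (μ i) h)) ∧ (∃ i, g i ≤ 0) ∧
      (M.Communicating → ∀ i, g i ≤ 0) := by
  set c : V → ℝ := cost lam S
  let β : ℕ → ℝ := fun n => 1 - 1 / (n + 2)
  have hβ1 (n : ℕ) : β n < 1 := sub_lt_self 1 (by positivity)
  have hβ (n : ℕ) : 0 ≤ β n :=
    sub_nonneg.2 ((div_le_one (by positivity)).2 (by linarith [n.cast_nonneg (α := ℝ)]))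
  choose v μ hv hle using fun n => M.exists_discounted c (hβ n) (hβ1 n)
  have hex (n : ℕ) : ∃ i, v n i ≤ 0 := by
    by_contra! hpos
    refine hS (v n) fun i a => ?_
    have : Nonempty V := ⟨i⟩
    obtain ⟨l, hl⟩ := Finite.exists_min (v n)
    have h1 := (hpos l).trans_le (M.le_mean i a hl)
    have h2 := mul_pos (sub_pos.2 (hβ1 n)) h1
    linarith [hle n i a]
  choose i hi using hex
  -- Pigeonhole: policies and states are finite in number, the discount factors are not.
  obtain ⟨⟨ν, j⟩, hinf⟩ := Finite.exists_infinite_fiber fun n => (μ n, i n)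
  rw [Set.infinite_coe_iff] at hinf
  obtain ⟨g, h, hg, hc⟩ := M.exists_poisson ν c
  have hfib : ∀ n ∈ (fun n => (μ n, i n)) ⁻¹' {(ν, j)}, μ n = ν ∧ i n = j := by
    intro n hn
    simpa using hn
  have hgap : ∀ n ∈ (fun n => (μ n, i n)) ⁻¹' {(ν, j)}, ∀ k,
      |(1 - β n) * v n k - g k| ≤ (1 - β n) * (2 * ‖h‖) := by
    intro n hn k
    obtain ⟨h1, -⟩ := hfib n hn
    exact abs_discounted_sub_gain_le (hβ n) (hβ1 n) hg hc (fun k => h1 ▸ hv n k) k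
  have hβn (n : ℕ) : 1 - β n = 1 / ((n : ℝ) + 2) := sub_sub_cancel _ _
  refine ⟨ν, g, h, hg, hc, ⟨j, nonpos_of_infinite_le_div (C := 2 * ‖h‖) hinf fun n hn => ?_⟩,
    fun hM k => ?_⟩
  · have h1 := (abs_le.1 (hgap n hn j)).1
    have h2 := mul_nonpos_of_nonneg_of_nonpos (sub_pos.2 (hβ1 n)).le (hi n)
    rw [(hfib n hn).2] at h2
    rw [div_eq_inv_mul, ← one_div, ← hβn]
    linarith
  · obtain ⟨K, -, hK⟩ := hM.exists_span_le (2 * ‖c‖)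
    refine nonpos_of_infinite_le_div (C := K + 2 * ‖h‖) hinf fun n hn => ?_
    -- Replacing `β` by `1` costs at most `(1 - β) * ‖v‖ ≤ ‖c‖`, so the span bound `K` is uniform in
    -- `n`.
    have hsub (i : V) (a : A i) : v n i ≤ 2 * ‖c‖ + M.mean i a (v n) := by
      have h1 := hle n i a
      have h2 := (abs_le.1 (norm_le_pi_norm c i)).2
      have h3 := mul_le_mul_of_nonneg_left (abs_le.1 (M.abs_mean_le i a (v n))).1
        (sub_pos.2 (hβ1 n)).le
      linarith [norm_le_of_discounted (hβ n) (hv n)]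
    have h1 := (abs_le.1 (hgap n hn k)).1
    have h2 := hi n
    rw [(hfib n hn).2] at h2
    have h3 : v n k ≤ K := by linarith [hK (v n) hsub k j]
    have h4 := mul_le_mul_of_nonneg_left h3 (sub_pos.2 (hβ1 n)).le
    rw [div_eq_inv_mul, ← one_div, ← hβn]
    linarith

end Duality

/-! ### The law of the controlled walk -/

section Walk

variable [Fintype V] [MeasurableSpace V] [MeasurableSingletonClass V]

instance (M : MDP V A) (μ : M.Policy) (s : V) : IsProbabilityMeasure (M.walk μ s) := by
  unfold walk; infer_instance

lemma walk_zero (M : MDP V A) (μ : M.Policy) (s : V) : ∀ᵐ x ∂(M.walk μ s), x 0 = s := by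
  have h : (M.walk μ s).map (Preorder.frestrictLe 0) =
      Measure.dirac ((MeasurableEquiv.piUnique fun _ : Finset.Iic 0 => V).symm s) := by
    have h1 : (Measure.dirac s).map (MeasurableEquiv.piUnique fun _ : Finset.Iic 0 => V).symm =
        Measure.dirac ((MeasurableEquiv.piUnique fun _ : Finset.Iic 0 => V).symm s) :=
      Measure.map_dirac' (MeasurableEquiv.measurable _) s
    have h2 : M.walk μ s = (Kernel.traj (X := fun _ => V) (M.step μ) 0) ∘ₘ
      (Measure.dirac s).map (MeasurableEquiv.piUnique fun _ : Finset.Iic 0 => V).symm := rfl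
    rw [h2, h1, Measure.dirac_bind (Kernel.measurable _),
      Kernel.traj_map_frestrictLe_apply, Kernel.partialTraj_self, Kernel.id_apply]
  have h0 : ∀ᵐ y ∂((M.walk μ s).map (Preorder.frestrictLe 0)),
      y ⟨0, Finset.mem_Iic.2 le_rfl⟩ = s := by
    rw [h]
    exact (ae_dirac_iff (Set.to_countable _).measurableSet).2 rfl
  exact ae_of_ae_map (by fun_prop) h0

/-- The Markov property at time `n`. -/
lemma lintegral_walk_step (M : MDP V A) (μ : M.Policy) (s : V) (n : ℕ)
    (G : ((_ : Finset.Iic n) → V) → ℝ≥0∞) (f : V → V → ℝ≥0∞) :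
    ∫⁻ x, G (Preorder.frestrictLe n x) * f (x n) (x (n + 1)) ∂(M.walk μ s) =
      ∫⁻ x, G (Preorder.frestrictLe n x) * ∑ j, f (x n) j * M.P (x n) (μ (x n)) j
        ∂(M.walk μ s) := by
  let last : ((_ : Finset.Iic n) → V) → V := fun y => y ⟨n, Finset.mem_Iic.2 le_rfl⟩
  have hm : Measurable fun p : ((_ : Finset.Iic n) → V) × V => G p.1 * f (last p.1) p.2 :=
    Measurable.of_discrete
  have h1 := Kernel.map_frestrictLe_trajMeasure_compProd_eq_map_trajMeasure
    (X := fun _ => V) (μ₀ := Measure.dirac s) (κ := M.step μ) (a := n)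
  calc ∫⁻ x, G (Preorder.frestrictLe n x) * f (x n) (x (n + 1)) ∂(M.walk μ s)
      = ∫⁻ p, G p.1 * f (last p.1) p.2
          ∂((M.walk μ s).map fun x => (Preorder.frestrictLe n x, x (n + 1))) :=
        (lintegral_map (g := fun x : ℕ → V => (Preorder.frestrictLe (π := fun _ => V) n x, x (n + 1)))
          hm ((Preorder.measurable_frestrictLe n).prodMk (measurable_pi_apply _))).symm
    _ = ∫⁻ p, G p.1 * f (last p.1) p.2
          ∂((M.walk μ s).map (Preorder.frestrictLe n) ⊗ₘ M.step μ n) := by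
        rw [walk, h1]
    _ = ∫⁻ y, ∫⁻ j, G y * f (last y) j ∂(M.step μ n y)
          ∂((M.walk μ s).map (Preorder.frestrictLe n)) := Measure.lintegral_compProd hm
    _ = ∫⁻ y, G y * ∑ j, f (last y) j * M.P (last y) (μ (last y)) j
          ∂((M.walk μ s).map (Preorder.frestrictLe n)) := by
        refine lintegral_congr fun y => ?_
        rw [lintegral_const_mul _ Measurable.of_discrete, lintegral_fintype]
        congr 1
        refine Finset.sum_congr rfl fun j _ => ?_
        congr 1
        exact PMF.toMeasure_apply_singleton _ _ (measurableSet_singleton j)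
    _ = _ := lintegral_map Measurable.of_discrete (by fun_prop)

lemma ae_prob_pos (M : MDP V A) (μ : M.Policy) (s : V) :
    ∀ᵐ x ∂(M.walk μ s), ∀ n, 0 < M.prob (x n) (μ (x n)) (x (n + 1)) := by
  classical
  refine ae_all_iff.2 fun n => ?_
  let f : V → V → ℝ≥0∞ := fun i j => if 0 < M.prob i (μ i) j then 0 else 1
  have h := M.lintegral_walk_step μ s n (fun _ => 1) f
  have h0 (i : V) : ∑ j, f i j * M.P i (μ i) j = 0 := by
    refine Finset.sum_eq_zero fun j _ => ?_
    by_cases hj : 0 < M.prob i (μ i) j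
    · simp [f, hj]
    · have : M.P i (μ i) j = 0 := by
        have h2 := le_antisymm (not_lt.1 hj) (M.prob_nonneg i (μ i) j)
        exact (ENNReal.toReal_eq_zero_iff _).1 h2 |>.resolve_right ((M.P i (μ i)).apply_ne_top j)
      rw [this, mul_zero]
  simp only [h0, one_mul, lintegral_zero] at h
  have hf : Measurable fun p : V × V => f p.1 p.2 := Measurable.of_discrete
  have hm : Measurable fun x : ℕ → V => f (x n) (x (n + 1)) :=
    hf.comp (g := fun p : V × V => f p.1 p.2) (f := fun x : ℕ → V => (x n, x (n + 1)))
      ((measurable_pi_apply n).prodMk (measurable_pi_apply (n + 1)))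
  filter_upwards [(lintegral_eq_zero_iff hm).1 h] with x hx
  by_contra hne
  simp [f, hne] at hx

/-- A set of states that is closed under the transitions is never left. -/
lemma ae_mem_of_closed (M : MDP V A) {μ : M.Policy} {R : Set V}
    (hR : ∀ i ∈ R, ∀ j, 0 < M.prob i (μ i) j → j ∈ R) {s : V} (hs : s ∈ R) :
    ∀ᵐ x ∂(M.walk μ s), ∀ n, x n ∈ R := by
  filter_upwards [M.walk_zero μ s, M.ae_prob_pos μ s] with x h0 hx n
  induction n with
  | zero => exact h0 ▸ hs
  | succ n ih => exact hR _ ih _ (hx n)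

/-- Conditioning on the history up to the last transition removes one factor at a time, each at the
price `q`. -/
lemma lintegral_prod_le (M : MDP V A) (μ : M.Policy) (s : V) (f : V → V → ℝ≥0∞) (q : ℝ≥0∞)
    (hf : ∀ i, ∑ j, f i j * M.P i (μ i) j ≤ q) (N : ℕ) :
    ∫⁻ x, ∏ k ∈ Finset.range N, f (x k) (x (k + 1)) ∂(M.walk μ s) ≤ q ^ N := by
  induction N with
  | zero => simp
  | succ N ih =>
    let G : ((_ : Finset.Iic N) → V) → ℝ≥0∞ := fun y => ∏ k : Fin N,
      f (y ⟨k, Finset.mem_Iic.2 k.2.le⟩) (y ⟨k + 1, Finset.mem_Iic.2 k.2⟩)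
    have hG (x : ℕ → V) :
        ∏ k ∈ Finset.range N, f (x k) (x (k + 1)) = G (Preorder.frestrictLe N x) :=
      Finset.prod_range _
    simp_rw [Finset.prod_range_succ, hG, lintegral_walk_step]
    simp_rw [hG] at ih
    have hGm : Measurable fun x : ℕ → V => G (Preorder.frestrictLe N x) :=
      (Measurable.of_discrete (f := G)).comp (by fun_prop)
    calc _ ≤ ∫⁻ x, G (Preorder.frestrictLe N x) * q ∂(M.walk μ s) :=
          lintegral_mono fun x => mul_le_mul_right (hf _) _
      _ = (∫⁻ x, G (Preorder.frestrictLe N x) ∂(M.walk μ s)) * q := lintegral_mul_const _ hGm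
      _ ≤ q ^ N * q := mul_le_mul_left ih _
      _ = q ^ (N + 1) := (pow_succ q N).symm

end Walk

lemma le_ofReal_of_forall_le_add {lam : ℝ} {a : ℝ≥0∞} (ha : ∀ n : ℕ, a ≤ ENNReal.ofReal (lam + 1 / (n + 1))) :
    a ≤ ENNReal.ofReal lam := by
  refine ge_of_tendsto' (x := atTop) ?_ ha
  have := tendsto_one_div_add_atTop_nhds_zero_nat (𝕜 := ℝ)
  simpa [Function.comp_def] using (ENNReal.continuous_ofReal.tendsto _).comp (this.const_add lam)

/-! ### Counting cycles along a trajectory -/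

section Cycles

variable [DecidableEq V]

/-- The left side may count time `0`, which `cycles` does not; the initial `1` in `cycles` pays for
it. -/
lemma card_le_cycles (S : Finset V) (x : ℕ → V) (N : ℕ) :
    ((Finset.range N).filter fun k => x k ∈ S).card ≤ cycles S x N := by
  have h : (Finset.range N).filter (fun k => x k ∈ S) ⊆
      insert 0 ((Finset.Icc 1 N).filter fun k => x k ∈ S) := by
    intro k
    simp only [Finset.mem_filter, Finset.mem_range, Finset.mem_insert, Finset.mem_Icc]
    rintro ⟨hk, hkS⟩
    by_cases h0 : k = 0
    · exact Or.inl h0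
    · exact Or.inr ⟨by omega, hkS⟩
  exact (Finset.card_le_card h).trans ((Finset.card_insert_le _ _).trans_eq (add_comm _ _))

lemma sub_le_sum_cost {lam : ℝ} (hlam : 0 ≤ lam) (S : Finset V) (x : ℕ → V) (N : ℕ) :
    N - lam * cycles S x N ≤ ∑ k ∈ Finset.range N, cost lam S (x k) := by
  have h1 (k : ℕ) : cost lam S (x k) = 1 - if x k ∈ S then lam else 0 := by
    unfold cost; split_ifs <;> ring
  simp_rw [h1, Finset.sum_sub_distrib, ← Finset.sum_filter, Finset.sum_const, Finset.card_range,
    nsmul_eq_mul, mul_one]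
  rw [mul_comm]
  exact sub_le_sub_left
    (mul_le_mul_of_nonneg_right (Nat.cast_le.2 (card_le_cycles S x N)) hlam) _

lemma one_le_cycles (S : Finset V) (x : ℕ → V) (N : ℕ) : 1 ≤ cycles S x N := Nat.le_add_right _ _

lemma abs_cost_le {lam : ℝ} (hlam : 0 ≤ lam) (S : Finset V) (i : V) : |cost lam S i| ≤ 1 + lam := by
  rw [abs_le]
  unfold cost
  split_ifs <;> constructor <;> linarith

lemma div_cycles_le {S : Finset V} {ρ : ℝ} (hρ : 0 ≤ ρ) {x : ℕ → V} {N : ℕ} (hx : ¬ ρ * cycles S x N < N + 1) :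
    ((N : ℝ≥0∞) + 1) / cycles S x N ≤ ENNReal.ofReal ρ := by
  refine ENNReal.div_le_of_le_mul ?_
  have h1 : (N : ℝ≥0∞) + 1 = ENNReal.ofReal (N + 1) := by
    rw [ENNReal.ofReal_add (by positivity) zero_le_one]; simp
  have h2 : (cycles S x N : ℝ≥0∞) = ENNReal.ofReal (cycles S x N) := by simp
  rw [h1, h2, ← ENNReal.ofReal_mul hρ]
  exact ENNReal.ofReal_le_ofReal (not_lt.1 hx)

end Cycles

/-! ### Exponential deviations and the cost bounds -/

section Deviation

variable [Fintype V] [DecidableEq V] {M : MDP V A} {S : Finset V} {μ : M.Policy} {lam : ℝ}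
  {h : V → ℝ}

/-- One step of the exponential supermartingale. -/
lemma sum_exp_mul_prob_le (hlam : 0 ≤ lam) {i : V}
    (hi : cost lam S i ≤ h i - M.mean i (μ i) h) {B θ : ℝ} (hB : 1 + lam + 2 * ‖h‖ ≤ B)
    (hθ : 0 ≤ θ) (hθB : θ * B ≤ 1) :
    ∑ j, ENNReal.ofReal (Real.exp (θ * (cost lam S i - h i + h j))) * M.P i (μ i) j ≤
      ENNReal.ofReal (Real.exp ((θ * B) ^ 2)) := by
  have hP (j : V) : M.P i (μ i) j = ENNReal.ofReal (M.prob i (μ i) j) :=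
    (ENNReal.ofReal_toReal ((M.P i (μ i)).apply_ne_top j)).symm
  simp_rw [hP, ← ENNReal.ofReal_mul (Real.exp_nonneg _)]
  rw [← ENNReal.ofReal_sum_of_nonneg fun j _ =>
    mul_nonneg (Real.exp_nonneg _) (M.prob_nonneg _ _ _)]
  refine ENNReal.ofReal_le_ofReal ?_
  -- The estimate `exp y ≤ 1 + y + y ^ 2` for `|y| ≤ 1`; the linear term has nonpositive mean by
  -- `hi`.
  have hexp (j : V) : Real.exp (θ * (cost lam S i - h i + h j)) ≤
      1 + θ * (cost lam S i - h i + h j) + (θ * B) ^ 2 := by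
    have h1 : |θ * (cost lam S i - h i + h j)| ≤ θ * B := by
      rw [abs_mul, abs_of_nonneg hθ]
      refine mul_le_mul_of_nonneg_left ?_ hθ
      have h2 := abs_le.1 (abs_cost_le hlam S i)
      have h3 := abs_le.1 (norm_le_pi_norm h i)
      have h4 := abs_le.1 (norm_le_pi_norm h j)
      rw [abs_le]
      constructor <;> linarith
    have h2 := (abs_le.1 (Real.abs_exp_sub_one_sub_id_le (h1.trans hθB))).2
    have h3 := sq_le_sq' (abs_le.1 h1).1 (abs_le.1 h1).2
    linarith
  calc ∑ j, Real.exp (θ * (cost lam S i - h i + h j)) * M.prob i (μ i) j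
      ≤ ∑ j, (1 + θ * (cost lam S i - h i + h j) + (θ * B) ^ 2) * M.prob i (μ i) j :=
        Finset.sum_le_sum fun j _ => mul_le_mul_of_nonneg_right (hexp j) (M.prob_nonneg _ _ _)
    _ = ∑ j, ((1 + θ * (cost lam S i - h i) + (θ * B) ^ 2) * M.prob i (μ i) j +
          θ * (M.prob i (μ i) j * h j)) := Finset.sum_congr rfl fun j _ => by ring
    _ = 1 + θ * (cost lam S i - h i) + (θ * B) ^ 2 + θ * M.mean i (μ i) h := by
        rw [Finset.sum_add_distrib, ← Finset.mul_sum, ← Finset.mul_sum, sum_prob, mul_one, mean]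
    _ ≤ (θ * B) ^ 2 + 1 := by nlinarith [mul_le_mul_of_nonneg_left hi hθ]
    _ ≤ Real.exp ((θ * B) ^ 2) := Real.add_one_le_exp _

variable [MeasurableSpace V] [MeasurableSingletonClass V] {R : Set V}

/-- Exponential deviation bound for the number of cycles, from the exponential supermartingale. -/
lemma exists_deviation_bound (hlam : 0 ≤ lam)
    (hR : ∀ i ∈ R, ∀ j, 0 < M.prob i (μ i) j → j ∈ R)
    (hh : ∀ i ∈ R, cost lam S i ≤ h i - M.mean i (μ i) h) {s : V} (hs : s ∈ R)
    {ε : ℝ} (hε : 0 < ε) (hε1 : ε ≤ 1) :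
    ∃ η D : ℝ, 0 < η ∧ ∀ N : ℕ,
      M.walk μ s {x | lam * cycles S x N + D ≤ (1 - ε) * N} ≤
        ENNReal.ofReal (Real.exp (-η * N)) := by
  classical
  set B : ℝ := 1 + lam + 2 * ‖h‖ with hB
  have hB1 : 1 ≤ B := by linarith [norm_nonneg h]
  have hB0 : 0 < B := by linarith
  -- This `θ` minimizes the Chernoff exponent `(θ * B) ^ 2 - θ * ε`, with value `-θ * ε / 2`.
  set θ : ℝ := ε / (2 * B ^ 2) with hθ
  have hθ0 : 0 < θ := by positivity
  have hθB2 : θ * B ^ 2 = ε / 2 := by rw [hθ]; field_simp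
  have hθB : θ * B ≤ 1 := by nlinarith
  refine ⟨θ * ε / 2, 2 * ‖h‖, by positivity, fun N => ?_⟩
  -- The drift condition is known only on `R`. The value `0` elsewhere makes the one-step bound hold
  -- at all states, and the walk from `s` never leaves `R`.
  let f : V → V → ℝ≥0∞ := fun i j =>
    if i ∈ R then ENNReal.ofReal (Real.exp (θ * (cost lam S i - h i + h j))) else 0
  have hf (i : V) : ∑ j, f i j * M.P i (μ i) j ≤ ENNReal.ofReal (Real.exp ((θ * B) ^ 2)) := by
    by_cases hi : i ∈ R
    · simpa only [f, if_pos hi] using sum_exp_mul_prob_le hlam (hh i hi) le_rfl hθ0.le hθB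
    · simp [f, hi]
  have hint := M.lintegral_prod_le μ s f _ hf N
  have hbad : M.walk μ s {x | lam * cycles S x N + 2 * ‖h‖ ≤ (1 - ε) * N} ≤
      M.walk μ s {x | ENNReal.ofReal (Real.exp (θ * (ε * N))) ≤
        ∏ k ∈ Finset.range N, f (x k) (x (k + 1))} := by
    refine measure_mono_ae ?_
    filter_upwards [M.ae_mem_of_closed hR hs] with x hx hxN
    have hxN' : lam * cycles S x N + 2 * ‖h‖ ≤ (1 - ε) * N := hxN
    have hprod : ∏ k ∈ Finset.range N, f (x k) (x (k + 1)) = ENNReal.ofReal (Real.exp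
        (θ * (∑ k ∈ Finset.range N, cost lam S (x k) + (h (x N) - h (x 0))))) := by
      simp only [f, if_pos (hx _)]
      rw [← ENNReal.ofReal_prod_of_nonneg fun k _ => Real.exp_nonneg _, ← Real.exp_sum,
        ← Finset.mul_sum, ← Finset.sum_range_sub (fun k => h (x k)), ← Finset.sum_add_distrib]
      congr 4
      ext k
      ring
    change _ ≤ _
    rw [hprod]
    refine ENNReal.ofReal_le_ofReal (Real.exp_le_exp.2 (mul_le_mul_of_nonneg_left ?_ hθ0.le))
    have h1 := sub_le_sum_cost hlam S x N
    have h3 := abs_le.1 (norm_le_pi_norm h (x 0))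
    have h4 := abs_le.1 (norm_le_pi_norm h (x N))
    linarith
  have hmeas : Measurable fun x : ℕ → V => ∏ k ∈ Finset.range N, f (x k) (x (k + 1)) := by
    refine Finset.measurable_fun_prod _ fun k _ => ?_
    exact (Measurable.of_discrete (f := fun p : V × V => f p.1 p.2)).comp
      (f := fun x : ℕ → V => (x k, x (k + 1)))
      ((measurable_pi_apply k).prodMk (measurable_pi_apply (k + 1)))
  refine hbad.trans ((meas_ge_le_lintegral_div hmeas.aemeasurable
    (ENNReal.ofReal_pos.2 (Real.exp_pos _)).ne' ENNReal.ofReal_ne_top).trans ?_)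
  refine (ENNReal.div_le_div_right hint _).trans ?_
  rw [← ENNReal.ofReal_pow (Real.exp_nonneg _), ← ENNReal.ofReal_div_of_pos (Real.exp_pos _),
    ← Real.exp_nat_mul, ← Real.exp_sub]
  refine ENNReal.ofReal_le_ofReal (Real.exp_le_exp.2 (le_of_eq ?_))
  linear_combination (N : ℝ) * θ * hθB2

/-- Cycles longer on average than `ρ > lam` become exponentially unlikely. -/
lemma exists_eventually_measure_le (hlam : 0 < lam)
    (hR : ∀ i ∈ R, ∀ j, 0 < M.prob i (μ i) j → j ∈ R)
    (hh : ∀ i ∈ R, cost lam S i ≤ h i - M.mean i (μ i) h) {s : V} (hs : s ∈ R)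
    {ρ : ℝ} (hρ : lam < ρ) :
    ∃ η : ℝ, 0 < η ∧ ∀ᶠ N : ℕ in atTop,
      M.walk μ s {x | ρ * cycles S x N < N + 1} ≤ ENNReal.ofReal (Real.exp (-η * N)) := by
  have hρ0 : 0 < ρ := hlam.trans hρ
  set r : ℝ := lam / ρ with hr
  have hr1 : r < 1 := (div_lt_one hρ0).2 hρ
  have hr0 : 0 < r := div_pos hlam hρ0
  -- On the event, `lam * C < r * N + r`. Half of the gap `1 - r` serves as `ε`; the other half
  -- absorbs `r + D` for large `N`.
  obtain ⟨η, D, hη, hdev⟩ := exists_deviation_bound hlam.le hR hh hs (ε := (1 - r) / 2)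
    (by linarith) (by linarith)
  refine ⟨η, hη, ?_⟩
  obtain ⟨N₀, hN₀⟩ := exists_nat_ge ((r + D) / ((1 - r) / 2))
  filter_upwards [eventually_ge_atTop N₀] with N hN
  refine (measure_mono fun x hx => ?_).trans (hdev N)
  have hx' : ρ * cycles S x N < N + 1 := hx
  change lam * cycles S x N + D ≤ (1 - (1 - r) / 2) * N
  have h1 : (N₀ : ℝ) ≤ N := by exact_mod_cast hN
  have h2 := (div_le_iff₀ (by linarith)).1 (hN₀.trans h1)
  have h3 : lam = r * ρ := by rw [hr]; field_simp
  have h4 := mul_lt_mul_of_pos_left hx' hr0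
  rw [h3]
  linarith

/-- Borel–Cantelli for each `ρ > lam`, then `ρ` decreasing to `lam` along a sequence. -/
theorem ae_pathAcpc_le (hlam : 0 < lam)
    (hR : ∀ i ∈ R, ∀ j, 0 < M.prob i (μ i) j → j ∈ R)
    (hh : ∀ i ∈ R, cost lam S i ≤ h i - M.mean i (μ i) h) {s : V} (hs : s ∈ R) :
    ∀ᵐ x ∂(M.walk μ s), pathAcpc S x ≤ ENNReal.ofReal lam := by
  suffices H : ∀ ρ, lam < ρ → ∀ᵐ x ∂(M.walk μ s), pathAcpc S x ≤ ENNReal.ofReal ρ by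
    have := ae_all_iff.2 fun n : ℕ =>
      H (lam + 1 / (n + 1)) (lt_add_of_pos_right lam (by positivity))
    filter_upwards [this] with x hx using le_ofReal_of_forall_le_add hx
  intro ρ hρ
  obtain ⟨η, hη, hev⟩ := exists_eventually_measure_le hlam hR hh hs hρ
  obtain ⟨N₀, hN₀⟩ := eventually_atTop.1 hev
  have hsum : ∑' N, M.walk μ s {x | ρ * cycles S x (N + N₀) < ((N + N₀ : ℕ) : ℝ) + 1} ≠ ∞ := by
    have h1 : Summable fun N : ℕ => Real.exp (-η * (N + N₀ : ℕ)) := by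
      refine (summable_nat_add_iff N₀ (f := fun N : ℕ => Real.exp (-η * N))).2 ?_
      simpa [mul_comm] using Real.summable_exp_nat_mul_iff.2 (neg_lt_zero.2 hη)
    refine ((ENNReal.tsum_le_tsum fun N => hN₀ (N + N₀) (Nat.le_add_left _ _)).trans_lt ?_).ne
    rw [← ENNReal.ofReal_tsum_of_nonneg (fun N => Real.exp_nonneg _) h1]
    exact ENNReal.ofReal_lt_top
  filter_upwards [ae_eventually_notMem hsum] with x hx
  refine limsup_le_of_le (by isBoundedDefault) ?_
  obtain ⟨N₁, hN₁⟩ := eventually_atTop.1 hx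
  filter_upwards [eventually_ge_atTop (N₁ + N₀)] with N hN
  have h1 := hN₁ (N - N₀) (by omega)
  rw [Nat.sub_add_cancel (by omega)] at h1
  exact (ENNReal.div_le_div_right le_self_add _).trans
    (div_cycles_le (hlam.trans hρ).le h1)

/-- Off the bad event the ratio is at most `ρ`; on it at most `N + 1`, which exponential decay
outweighs. -/
theorem acpc_le (hlam : 0 < lam)
    (hR : ∀ i ∈ R, ∀ j, 0 < M.prob i (μ i) j → j ∈ R)
    (hh : ∀ i ∈ R, cost lam S i ≤ h i - M.mean i (μ i) h) {s : V} (hs : s ∈ R) :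
    M.acpc S μ s ≤ ENNReal.ofReal lam := by
  refine le_ofReal_of_forall_le_add fun n => ?_
  set ρ : ℝ := lam + 1 / (n + 1) with hρ'
  have hρ : lam < ρ := lt_add_of_pos_right lam (by positivity)
  have hρ0 : 0 ≤ ρ := (hlam.trans hρ).le
  obtain ⟨η, hη, hev⟩ := exists_eventually_measure_le hlam hR hh hs hρ
  have hlim : Tendsto (fun N : ℕ => ENNReal.ofReal (ρ + (N + 1) * Real.exp (-η * N))) atTop
      (nhds (ENNReal.ofReal ρ)) := by
    have h1 := (tendsto_pow_const_mul_const_pow_of_lt_one 1 (Real.exp_nonneg (-η))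
      (Real.exp_lt_one_iff.2 (neg_lt_zero.2 hη))).add
      (tendsto_pow_atTop_nhds_zero_of_lt_one (Real.exp_nonneg (-η))
        (Real.exp_lt_one_iff.2 (neg_lt_zero.2 hη)))
    have h2 := (ENNReal.continuous_ofReal.tendsto _).comp (h1.const_add ρ)
    rw [add_zero, add_zero] at h2
    refine h2.congr fun N => ?_
    simp only [Function.comp_apply, pow_one, ← Real.exp_nat_mul]
    congr 2
    rw [mul_comm (N : ℝ) (-η)]
    ring
  refine (limsup_le_limsup ?_).trans_eq hlim.limsup_eq
  filter_upwards [hev] with N hN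
  let bad : Set (ℕ → V) := {x | ρ * cycles S x N < N + 1}
  calc _ ≤ ∫⁻ x, ENNReal.ofReal ρ + bad.indicator (fun _ => (N : ℝ≥0∞) + 1) x ∂(M.walk μ s) := by
        refine lintegral_mono fun x => ?_
        simp only [Finset.sum_const, Finset.card_range, nsmul_eq_mul, mul_one, Nat.cast_add,
          Nat.cast_one]
        by_cases hx : x ∈ bad
        · rw [Set.indicator_of_mem hx]
          refine le_trans (ENNReal.div_le_of_le_mul ?_) le_add_self
          exact le_mul_of_one_le_right' (by exact_mod_cast one_le_cycles S x N)
        · exact (div_cycles_le hρ0 hx).trans le_self_add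
    _ ≤ ENNReal.ofReal ρ + ((N : ℝ≥0∞) + 1) * M.walk μ s bad := by
        rw [lintegral_add_left measurable_const, lintegral_const, measure_univ, mul_one]
        gcongr
        exact lintegral_indicator_const_le _ _
    _ ≤ ENNReal.ofReal ρ + ((N : ℝ≥0∞) + 1) * ENNReal.ofReal (Real.exp (-η * N)) := by
        gcongr
    _ = _ := by
        rw [ENNReal.ofReal_add hρ0 (by positivity), ENNReal.ofReal_mul (by positivity),
          ENNReal.ofReal_add (by positivity) zero_le_one]
        simp

end Deviation

end MDP

end

/-! ### The main theorem -/

theorem mainTheorem5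
    {V : Type*} [Fintype V] [DecidableEq V] [MeasurableSpace V] [MeasurableSingletonClass V]
    {A : V → Type*} [∀ i, Fintype (A i)] [∀ i, Nonempty (A i)] (M : MDP V A) :
    -- the volume is decreasing and supermodular in the set of states
    (∀ ζ : ℝ, 0 < ζ → ∀ lam : ℝ,
      (0 ≤ lam → Antitone (M.vol ζ lam)) ∧ IsSupermodularFun (M.vol ζ lam)) ∧
    -- zero volume bounds the minimum average cost per cycle, over initial states and policies
    (∀ lam : ℝ, ∃ ζ₀ : ℝ, 0 < ζ₀ ∧ ∀ ζ : ℝ, ζ₀ ≤ ζ → ∀ S : Finset V, M.vol ζ lam S = 0 →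
      ∃ (μ : M.Policy) (s : V), M.acpc S μ s ≤ ENNReal.ofReal lam ∧
        ∀ᵐ x ∂(M.walk μ s), MDP.pathAcpc S x ≤ ENNReal.ofReal lam) ∧
    -- if all states communicate, one policy attains the bound from every initial state
    (M.Communicating → ∃ ζ₀ : ℝ, 0 < ζ₀ ∧ ∀ ζ : ℝ, ζ₀ ≤ ζ → ∀ (lam : ℝ) (S : Finset V),
      M.vol ζ lam S = 0 →
      ∃ μ : M.Policy, ∀ s : V, M.acpc S μ s ≤ ENNReal.ofReal lam ∧
        ∀ᵐ x ∂(M.walk μ s), MDP.pathAcpc S x ≤ ENNReal.ofReal lam) := by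
  refine ⟨fun ζ _ lam => ⟨M.vol_antitone ζ, M.vol_supermodular ζ lam⟩, fun lam => ?_,
    fun hM => ?_⟩
  · obtain ⟨ζ₀, hζ₀, H⟩ := M.exists_forall_not_strictlyFeasible lam
    refine ⟨ζ₀, hζ₀, fun ζ hζ S hvol => ?_⟩
    have hS := H ζ hζ S hvol
    -- For `lam < 1` the zero vector is strictly feasible, so the truncation in `ENNReal.ofReal lam`
    -- never acts.
    have hlam : 0 < lam := zero_lt_one.trans_le (MDP.one_le_of_forall_not_strictlyFeasible hS)
    obtain ⟨μ, g, h, hg, hc, ⟨i, hi⟩, -⟩ := MDP.exists_gain_nonpos hS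
    have : Nonempty V := ⟨i⟩
    -- The state `i` with `g i ≤ 0` may lead to states of positive gain; a minimizer of `g` cannot.
    obtain ⟨s, hs⟩ := Finite.exists_min g
    have hR : ∀ k ∈ {k | g k = g s}, ∀ j, 0 < M.prob k (μ k) j → j ∈ {k | g k = g s} := by
      intro k hk j hkj
      have hk' : g k = g s := hk
      exact (MDP.closed_argmin_of_harmonic hg (fun l => hk'.trans_le (hs l)) hkj).trans hk'
    have hh : ∀ k ∈ {k | g k = g s}, MDP.cost lam S k ≤ h k - M.mean k (μ k) h := by
      intro k hk
      have hk' : g k = g s := hk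
      linarith [hc k, hs i]
    exact ⟨μ, s, MDP.acpc_le hlam hR hh rfl, MDP.ae_pathAcpc_le hlam hR hh rfl⟩
  · obtain ⟨ζ₀, hζ₀, H⟩ := hM.exists_forall_not_strictlyFeasible
    refine ⟨ζ₀, hζ₀, fun ζ hζ lam S hvol => ?_⟩
    have hS := H ζ hζ lam S hvol
    have hlam : 0 < lam := zero_lt_one.trans_le (MDP.one_le_of_forall_not_strictlyFeasible hS)
    obtain ⟨μ, g, h, -, hc, -, hg⟩ := MDP.exists_gain_nonpos hS
    have hR : ∀ k ∈ Set.univ, ∀ j, 0 < M.prob k (μ k) j → j ∈ Set.univ := fun _ _ _ _ => trivial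
    have hh : ∀ k ∈ Set.univ, MDP.cost lam S k ≤ h k - M.mean k (μ k) h := by
      intro k _
      linarith [hc k, hg hM k]
    exact ⟨μ, fun s => ⟨MDP.acpc_le hlam hR hh trivial, MDP.ae_pathAcpc_le hlam hR hh trivial⟩⟩
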